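/- Let $d\in\mathbb N$, let $p>2$ be an even integer or $p=\infty$, and let $p'$ be the conjugate exponent, $1/p+1/p'=1$. Let $\mathcal F$ denote the Fourier transform on tempered distributions on $\mathbb R^d$, normalized by $\widehat f(\xi)=\int_{\mathbb R^d}e^{-2\pi i x\cdot\xi}f(x)\,dx$ on Schwartz functions, and let $\mathcal F(L^{p'}(\mathbb R^d))$ be the space of all tempered distributions of the form $\widehat h$ with $h\in L^{p'}(\mathbb R^d)$. Let $f,g\in\mathcal F(L^{p'}(\mathbb R^d))$ be complex-valued, so that $\widehat f,\widehat g\in L^{p'}(\mathbb R^d)$, and suppose that $|\widehat f(\xi)|\le\widehat g(\xi)$ for a.e. $\xi\in\mathbb R^d$ (in particular $\widehat g$ is real and nonnegative a.e.). Suppose moreover that $\widehat f$ is continuous (that is, it has a continuous representative, again denoted $\widehat f$) and that the set $\{\xi\in\mathbb R^d: |\widehat f(\xi)|>0\}$ is connected (the empty set being allowed). Then $f,g\in L^p(\mathbb R^d)$, and $$\|f\|_{L^p}=\|g\|_{L^p}$$ holds if and only if there exist $\alpha\in\mathbb R$ and $\beta\in\mathbb R^d$ such that $\widehat g$ has a continuous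 representative (again denoted $\widehat g$) with $$\widehat f(\xi)=e^{i(\alpha+\beta\cdot\xi)}\,\widehat g(\xi)\qquad\text{for all }\xi\in\mathbb R^d .$$ -/

import Mathlib

open MeasureTheory
open scoped ENNReal SchwartzMap FourierTransform RealInnerProductSpace



/-- `ℝ^d` with its Euclidean structure. -/
abbrev Rd (d : ℕ) : Type := EuclideanSpace ℝ (Fin d)

/-- The space `𝓕(L^q(ℝ^d))`: all tempered distributions which are the Fourier transform (in the
sense of tempered distributions, with kernel `exp (-2πi x·ξ)`) of a function in `L^q(ℝ^d)`. -/
def fourierImageLp (d : ℕ) (q : ℝ≥0∞) [Fact (1 ≤ q)] : Set 𝓢'(Rd d, ℂ) :=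
  {f | ∃ h : Lp ℂ q (volume : Measure (Rd d)), f = 𝓕 (h : 𝓢'(Rd d, ℂ))}

/-- The tempered distribution `u` is an `L^q` function, and the function `F` (defined pointwise) is
a representative of it. -/
def IsRepresentative {d : ℕ} (q : ℝ≥0∞) [Fact (1 ≤ q)] (u : 𝓢'(Rd d, ℂ)) (F : Rd d → ℂ) : Prop :=
  ∃ U : Lp ℂ q (volume : Measure (Rd d)), (U : 𝓢'(Rd d, ℂ)) = u ∧ U =ᵐ[volume] F

/-! Write F and G for the transforms of f and g, so |F| ≤ G a.e., and let p = 2(k+1) with k ≥ 1.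
Then f^(k+1) is the inverse transform of the (k+1)-fold convolution power of F, and Plancherel turns
‖f‖_p^(k+1) into the L² norm of that power. Young's inequality makes these powers meaningful for F
in L^{p'}; the norm identity passes from simple functions to F by dominated convergence
(`exists_Lp_eq_fourierInv`).

The convolution powers of F are dominated pointwise by those of G. Equal L² norms therefore force
equality a.e. at level k+1. This equality descends one factor at a time
(`lconvPow_le_enorm_convPow_of_succ`): one factor gives |F| = G a.e., and two factors give |F * F| =
|F| * |F| a.e. Equality in the triangle inequality means that t ↦ F(t)F(x-t) has constant phase, for
every x by continuity. The phase of F is then locally a character up to a constant, with the same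
frequency around every point of the support, and connectedness makes the constant global
(`exists_eq_exp_mul_norm_of_phase`).

For p = ∞ the transforms are integrable. The sup norm of g is g(0) = ∫ G, while |f| attains its
maximum at some x by Riemann–Lebesgue. Equality in the triangle inequality at x gives the affine
phase directly.

Conversely, modulating by an affine phase multiplies convolution powers by a unimodular factor and
translates inverse transforms, so norms are unchanged. -/

/-! ### Convolution powers and Young's inequality. -/

section ConvolutionPower

open Filter Topology

variable {E : Type*} [NormedAddCommGroup E] [InnerProductSpace ℝ E] [FiniteDimensional ℝ E]
  [MeasurableSpace E] [BorelSpace E]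

/-- The `(k + 1)`-fold convolution of `G` with itself, as a Lebesgue integral. -/
noncomputable def lconvPow (G : E → ℝ≥0∞) : ℕ → E → ℝ≥0∞
  | 0 => G
  | k + 1 => fun x => ∫⁻ t, G t * lconvPow G k (x - t)

/-- The `(k + 1)`-fold convolution of `F` with itself, as a Bochner integral. -/
noncomputable def convPow (F : E → ℂ) : ℕ → E → ℂ
  | 0 => F
  | k + 1 => fun x => ∫ t, F t * convPow F k (x - t)

theorem measurable_lconvPow {G : E → ℝ≥0∞} (hG : Measurable G) (k : ℕ) :
    Measurable (lconvPow G k) := by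
  induction k with
  | zero => exact hG
  | succ k ih =>
    exact Measurable.lintegral_prod_right'
      (f := fun z : E × E => G z.2 * lconvPow G k (z.1 - z.2)) (by fun_prop)

theorem stronglyMeasurable_convPow {F : E → ℂ} (hF : Measurable F) (k : ℕ) :
    StronglyMeasurable (convPow F k) := by
  induction k with
  | zero => exact hF.stronglyMeasurable
  | succ k ih =>
    have := ih.measurable
    exact StronglyMeasurable.integral_prod_right
      (f := fun x t : E => F t * convPow F k (x - t))
      (Measurable.stronglyMeasurable (by unfold Function.uncurry; fun_prop))

theorem enorm_convPow_le (F : E → ℂ) (k : ℕ) (x : E) :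
    ‖convPow F k x‖ₑ ≤ lconvPow (fun y => ‖F y‖ₑ) k x := by
  induction k generalizing x with
  | zero => exact le_rfl
  | succ k ih =>
    refine (enorm_integral_le_lintegral_enorm _).trans (lintegral_mono fun t => ?_)
    simp only [enorm_mul]
    gcongr
    exact ih _

theorem ae_comp_sub_left {P : E → Prop} (h : ∀ᵐ y, P y) (x : E) : ∀ᵐ t, P (x - t) :=
  (quasiMeasurePreserving_sub_left volume x).ae h

theorem lconvPow_mono_ae {G H : E → ℝ≥0∞} (h : ∀ᵐ y, G y ≤ H y) (k : ℕ) :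
    ∀ᵐ x, lconvPow G k x ≤ lconvPow H k x := by
  induction k with
  | zero => exact h
  | succ k ih =>
    refine Eventually.of_forall fun x => lintegral_mono_ae ?_
    filter_upwards [h, ae_comp_sub_left ih x] with t h1 h2
    gcongr

theorem convPow_congr_ae {F G : E → ℂ} (h : ∀ᵐ y, F y = G y) (k : ℕ) :
    ∀ᵐ x, convPow F k x = convPow G k x := by
  induction k with
  | zero => exact h
  | succ k ih =>
    refine Eventually.of_forall fun x => integral_congr_ae ?_
    filter_upwards [h, ae_comp_sub_left ih x] with t h1 h2
    rw [h1, h2]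

/-- The characters at t and x - t multiply to the character at x, which leaves the integral. -/
theorem convPow_modulation (G : E → ℂ) (α : ℝ) (β : E) (k : ℕ) (x : E) :
    convPow (fun y => Complex.exp (Complex.I * ((α + ⟪β, y⟫ : ℝ) : ℂ)) * G y) k x =
      Complex.exp (Complex.I * (((k + 1) * α + ⟪β, x⟫ : ℝ) : ℂ)) * convPow G k x := by
  induction k generalizing x with
  | zero => simp [convPow]
  | succ k ih =>
    simp only [convPow]
    rw [← integral_const_mul]
    congr 1
    ext t
    rw [ih, mul_mul_mul_comm, ← Complex.exp_add]
    congr 2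
    rw [inner_sub_right]
    push_cast
    ring

/-- Young's convolution inequality for nonnegative functions, with exponents `1 / A`, `1 / B` and
`1 / (A + B - 1)`. -/
theorem lintegral_convolution_rpow_le {f g : E → ℝ≥0∞} (hf : Measurable f) (hg : Measurable g)
    {A B : ℝ} (hA : A ≤ 1) (hB : B ≤ 1) (hAB : 0 < A + B - 1) :
    (∫⁻ x, (∫⁻ t, f t * g (x - t)) ^ (1 / (A + B - 1))) ^ (A + B - 1) ≤
      (∫⁻ x, f x ^ (1 / A)) ^ A * (∫⁻ x, g x ^ (1 / B)) ^ B := by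
  have hA0 : 0 < A := by linarith
  have hB0 : 0 < B := by linarith
  set R := A + B - 1 with hR
  set φ : E → ℝ≥0∞ := fun x => f x ^ (1 / A) with hφ
  set ψ : E → ℝ≥0∞ := fun x => g x ^ (1 / B) with hψ
  have mφ : Measurable φ := hf.pow_const _
  have mψ : Measurable ψ := hg.pow_const _
  -- Three-factor Hölder for f(t)g(x-t) = (φψ)^R φ^(A-R) ψ^(B-R), whose weights are nonnegative and
  -- sum to 1 since A - R = 1 - B and B - R = 1 - A.
  have key (x : E) : ∫⁻ t, f t * g (x - t) ≤
      (∫⁻ t, φ t * ψ (x - t)) ^ R * ((∫⁻ t, φ t) ^ (A - R) * (∫⁻ t, ψ t) ^ (B - R)) := by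
    have h := ENNReal.lintegral_mul_prod_norm_pow_le (μ := (volume : Measure E)) Finset.univ
      (g := fun t => φ t * ψ (x - t))
      (f := (![φ, fun t => ψ (x - t)] : Fin 2 → E → ℝ≥0∞)) (by fun_prop)
      (by intro i _; fin_cases i <;> simp <;> fun_prop) R (p := ![A - R, B - R])
      (by simp; ring) hAB.le (by intro i _; fin_cases i <;> simp <;> linarith)
    simp only [Fin.prod_univ_two, Matrix.cons_val_zero, Matrix.cons_val_one] at h
    rw [lintegral_sub_left_eq_self ψ x] at h
    refine le_trans (le_of_eq (lintegral_congr fun t => ?_)) h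
    rw [ENNReal.mul_rpow_of_nonneg _ _ hAB.le, mul_mul_mul_comm,
      ← ENNReal.rpow_add_of_nonneg _ _ hAB.le (by linarith),
      ← ENNReal.rpow_add_of_nonneg _ _ hAB.le (by linarith), hφ, hψ]
    simp only [← ENNReal.rpow_mul]
    rw [show 1 / A * (R + (A - R)) = 1 by field_simp; ring,
      show 1 / B * (R + (B - R)) = 1 by field_simp; ring, ENNReal.rpow_one, ENNReal.rpow_one]
  have hRi : 0 ≤ 1 / R := by positivity
  set c := (∫⁻ t, φ t) ^ (A - R) * (∫⁻ t, ψ t) ^ (B - R)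
  have hfub : ∫⁻ x, ∫⁻ t, φ t * ψ (x - t) = (∫⁻ t, φ t) * ∫⁻ t, ψ t := by
    rw [lintegral_lintegral_swap (by unfold Function.uncurry; fun_prop),
      ← lintegral_mul_const _ mφ]
    refine lintegral_congr fun t => ?_
    rw [lintegral_const_mul _ (by fun_prop), lintegral_sub_right_eq_self ψ t]
  calc (∫⁻ x, (∫⁻ t, f t * g (x - t)) ^ (1 / R)) ^ R
      ≤ (∫⁻ x, (∫⁻ t, φ t * ψ (x - t)) * c ^ (1 / R)) ^ R := by
        gcongr with x
        refine (ENNReal.rpow_le_rpow (key x) hRi).trans (le_of_eq ?_)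
        rw [ENNReal.mul_rpow_of_nonneg _ _ hRi, ← ENNReal.rpow_mul,
          mul_one_div_cancel hAB.ne', ENNReal.rpow_one]
    _ = ((∫⁻ t, φ t) * ∫⁻ t, ψ t) ^ R * c := by
        rw [lintegral_mul_const _ (Measurable.lintegral_prod_right'
          (f := fun z : E × E => φ z.2 * ψ (z.1 - z.2)) (by fun_prop)), hfub,
          ENNReal.mul_rpow_of_nonneg _ _ hAB.le, ← ENNReal.rpow_mul,
          one_div_mul_cancel hAB.ne', ENNReal.rpow_one]
    _ = _ := by
        rw [ENNReal.mul_rpow_of_nonneg _ _ hAB.le, mul_mul_mul_comm,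
          ← ENNReal.rpow_add_of_nonneg _ _ hAB.le (by linarith),
          ← ENNReal.rpow_add_of_nonneg _ _ hAB.le (by linarith)]
        congr 2 <;> ring

/-- Iterated Young: each further factor lowers the reciprocal exponent by c. The case of interest is
c = 1/p. -/
theorem lintegral_lconvPow_rpow_le {G : E → ℝ≥0∞} (hG : Measurable G) {c : ℝ} (hc : 0 < c)
    (k : ℕ) (hk : (k + 1) * c < 1) :
    (∫⁻ x, lconvPow G k x ^ (1 / (1 - (k + 1) * c))) ^ (1 - (k + 1) * c) ≤
      ((∫⁻ x, G x ^ (1 / (1 - c))) ^ (1 - c)) ^ (k + 1) := by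
  induction k with
  | zero => simp [lconvPow]
  | succ k ih =>
    push_cast at hk ⊢
    have hk' : (k + 1) * c < 1 := by nlinarith
    have h := lintegral_convolution_rpow_le hG (measurable_lconvPow hG k) (A := 1 - c)
      (B := 1 - (k + 1) * c) (by linarith) (by nlinarith) (by nlinarith)
    rw [show 1 - c + (1 - (k + 1) * c) - 1 = 1 - (k + 1 + 1) * c by ring] at h
    refine h.trans ?_
    rw [pow_succ' _ (k + 1)]
    gcongr
    exact ih hk'

theorem lconvPow_lt_top_ae {G : E → ℝ≥0∞} (hG : Measurable G) {c : ℝ} (hc : 0 < c)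
    (k : ℕ) (hk : (k + 1) * c < 1) (hfin : ∫⁻ x, G x ^ (1 / (1 - c)) < ∞) :
    ∀ᵐ x, lconvPow G k x < ∞ := by
  have hk1 : 0 < 1 - (k + 1) * c := by linarith
  have hc1 : 0 ≤ 1 - c := by nlinarith [(Nat.cast_nonneg k : (0:ℝ) ≤ k)]
  have h : (∫⁻ x, lconvPow G k x ^ (1 / (1 - (k + 1) * c))) ^ (1 - (k + 1) * c) < ∞ :=
    (lintegral_lconvPow_rpow_le hG hc k hk).trans_lt
      (ENNReal.pow_lt_top (ENNReal.rpow_lt_top_of_nonneg hc1 hfin.ne))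
  rw [ENNReal.rpow_lt_top_iff_of_pos hk1] at h
  filter_upwards [ae_lt_top ((measurable_lconvPow hG k).pow_const _) h.ne] with x hx
  rwa [ENNReal.rpow_lt_top_iff_of_pos (by positivity)] at hx

/-- Valid at every x: where the Lebesgue integral is infinite, both sides are 0 by convention. -/
theorem convPow_ofReal_toReal {G : E → ℝ≥0∞} (hG : Measurable G) (k : ℕ)
    (hfin : ∀ j ≤ k, ∀ᵐ x, lconvPow G j x < ∞) (x : E) :
    convPow (fun y => ((G y).toReal : ℂ)) k x = ((lconvPow G k x).toReal : ℂ) := by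
  induction k generalizing x with
  | zero => rfl
  | succ k ih =>
    have ih' := ih fun j hj => hfin j (hj.trans k.le_succ)
    have hm := measurable_lconvPow hG k
    simp only [convPow, ih', lconvPow]
    rw [← integral_toReal (by fun_prop)]
    · rw [← integral_complex_ofReal]
      simp
    · filter_upwards [hfin 0 (by lia), ae_comp_sub_left (hfin k k.le_succ) x] with t h1 h2
      exact ENNReal.mul_lt_top h1 h2

theorem tendsto_convPow {F : ℕ → E → ℂ} {F₀ : E → ℂ} {G : E → ℝ≥0∞}
    (hF : ∀ n, Measurable (F n)) (hG : Measurable G) (hle : ∀ n x, ‖F n x‖ₑ ≤ G x)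
    (hlim : ∀ x, Tendsto (fun n => F n x) atTop (𝓝 (F₀ x))) (k : ℕ)
    (hfin : ∀ j ≤ k, ∀ᵐ x, lconvPow G j x < ∞) :
    ∀ᵐ x, Tendsto (fun n => convPow (F n) k x) atTop (𝓝 (convPow F₀ k x)) := by
  induction k with
  | zero => exact Eventually.of_forall hlim
  | succ k ih =>
    have ih' := ih fun j hj => hfin j (hj.trans k.le_succ)
    have hb (n : ℕ) : ∀ᵐ x, ‖convPow (F n) k x‖ₑ ≤ lconvPow G k x := by
      filter_upwards [lconvPow_mono_ae (Eventually.of_forall (hle n)) k] with x hx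
      exact (enorm_convPow_le _ _ _).trans hx
    have hm := measurable_lconvPow hG k
    filter_upwards [hfin (k + 1) le_rfl] with x hx
    have hfin' : ∀ᵐ t, G t < ∞ ∧ lconvPow G k (x - t) < ∞ := by
      filter_upwards [hfin 0 (by lia), ae_comp_sub_left (hfin k k.le_succ) x] with t h1 h2
      exact ⟨h1, h2⟩
    refine tendsto_integral_of_dominated_convergence
      (fun t => (G t * lconvPow G k (x - t)).toReal) (fun n => ?_) ?_ (fun n => ?_) ?_
    · have := (stronglyMeasurable_convPow (hF n) k).measurable
      have := hF n
      exact Measurable.aestronglyMeasurable (by fun_prop)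
    · exact integrable_toReal_of_lintegral_ne_top (by fun_prop) hx.ne
    · filter_upwards [hfin', ae_comp_sub_left (hb n) x] with t ht h2
      rw [← toReal_enorm, enorm_mul]
      exact ENNReal.toReal_mono (ENNReal.mul_lt_top ht.1 ht.2).ne
        (mul_le_mul' (hle n t) h2)
    · filter_upwards [ae_comp_sub_left ih' x] with t ht
      exact (hlim t).mul ht

end ConvolutionPower

/-! ### From local multiplicativity to an affine phase. -/

section LocalCharacter

open Filter Topology

/-- A locally additive real function which is continuous at zero agrees near zero with a continuous
linear functional. -/
theorem exists_clm_eq_of_locally_additive {E : Type*} [NormedAddCommGroup E] [NormedSpace ℝ E]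
    {L : E → ℝ} {r : ℝ} (hr : 0 < r) (hL : ContinuousAt L 0)
    (hadd : ∀ h k, ‖h‖ < r → ‖k‖ < r → L (h + k) = L h + L k) :
    ∃ M : E →L[ℝ] ℝ, ∀ h, ‖h‖ < r → L h = M h := by
  have hsmall (h : E) (N : ℕ) (hN : ‖h‖ < N * r) : ‖(N : ℝ)⁻¹ • h‖ < r := by
    have hN0 : (0 : ℝ) < N := by
      by_contra hcon
      have : (N : ℝ) = 0 := le_antisymm (not_lt.mp hcon) N.cast_nonneg
      rw [this, zero_mul] at hN
      exact absurd hN (norm_nonneg h).not_gt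
    rw [norm_smul, norm_inv, Real.norm_natCast, inv_mul_lt_iff₀ hN0]
    exact hN
  have h0 : L 0 = 0 := by simpa using hadd 0 0 (by simpa) (by simpa)
  have hmul (k : E) (n : ℕ) (hk : n * ‖k‖ < r) : L ((n : ℝ) • k) = n * L k := by
    induction n with
    | zero => simp [h0]
    | succ n ih =>
      push_cast at hk ⊢
      have hk1 : n * ‖k‖ < r := by nlinarith [norm_nonneg k]
      have hk2 : ‖k‖ < r := by
        nlinarith [norm_nonneg k, mul_nonneg n.cast_nonneg (norm_nonneg k) (α := ℝ)]
      rw [add_smul, one_smul, hadd _ _ (by simpa [norm_smul] using hk1) hk2, ih hk1]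
      ring
  have hdiv (k : E) (n : ℕ) (hn : 0 < n) (hk : ‖k‖ < r) : (n : ℝ) * L ((n : ℝ)⁻¹ • k) = L k := by
    have hn' : (0 : ℝ) < n := by exact_mod_cast hn
    rw [← hmul _ n, smul_inv_smul₀ hn'.ne']
    rw [norm_smul, norm_inv, Real.norm_natCast, mul_inv_cancel_left₀ hn'.ne']
    exact hk
  have hex (h : E) : ∃ n : ℕ, 0 < n ∧ ‖h‖ < n * r := by
    obtain ⟨n, hn⟩ := exists_nat_gt (‖h‖ / r)
    have := (div_lt_iff₀ hr).mp hn
    refine ⟨n, ?_, this⟩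
    have : (0 : ℝ) < n := lt_of_le_of_lt (by positivity) hn
    exact_mod_cast this
  choose n hn0 hn using hex
  -- Extension by scaling into the ball; `hMN` shows that the choice of scale is immaterial, so
  -- additivity can be tested at a common scale.
  set M : E → ℝ := fun h => n h * L ((n h : ℝ)⁻¹ • h) with hM
  have hMN (h : E) (N : ℕ) (hN0 : 0 < N) (hN : ‖h‖ < N * r) :
      M h = N * L ((N : ℝ)⁻¹ • h) := by
    have e1 := hdiv _ N hN0 (hsmall h _ (hn h))
    have e2 := hdiv _ (n h) (hn0 h) (hsmall h N hN)
    rw [hM]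
    simp only
    rw [← e1, ← e2, smul_comm]
    ring
  have hMadd (h k : E) : M (h + k) = M h + M k := by
    obtain ⟨N, hN⟩ := exists_nat_gt ((‖h‖ + ‖k‖) / r)
    have hN0 : (0 : ℝ) < N := lt_of_le_of_lt (by positivity) hN
    rw [div_lt_iff₀ hr] at hN
    have hN0' : 0 < N := by exact_mod_cast hN0
    have h1 : ‖h‖ < N * r := by linarith [norm_nonneg k]
    have h2 : ‖k‖ < N * r := by linarith [norm_nonneg h]
    rw [hMN _ N hN0' ((norm_add_le h k).trans_lt hN), hMN h N hN0' h1, hMN k N hN0' h2, smul_add,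
      hadd _ _ (hsmall h N h1) (hsmall k N h2), mul_add]
  have hML (h : E) (hh : ‖h‖ < r) : L h = M h := by
    rw [hMN h 1 one_pos (by simpa using hh)]
    simp
  let A : E →+ ℝ := AddMonoidHom.mk' M hMadd
  have hA : Continuous A := by
    refine continuous_of_continuousAt_zero A (hL.congr ?_)
    filter_upwards [Metric.ball_mem_nhds (0 : E) hr] with h hh
    exact hML h (by simpa using hh)
  exact ⟨A.toRealLinearMap hA, fun h hh => hML h hh⟩

variable {E : Type*} [NormedAddCommGroup E] [InnerProductSpace ℝ E] [CompleteSpace E]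

/-- A locally multiplicative unimodular function which is continuous at zero is locally a
character. -/
theorem exists_eq_exp_inner_of_locally_multiplicative {χ : E → ℂ} (hχ : ContinuousAt χ 0)
    (hnorm : ∀ᶠ h in 𝓝 0, ‖χ h‖ = 1)
    (hmul : ∀ᶠ z in 𝓝 (0 : E × E), χ (z.1 + z.2) = χ z.1 * χ z.2) :
    ∃ β : E, ∀ᶠ h in 𝓝 0, χ h = Complex.exp (Complex.I * (⟪β, h⟫ : ℝ)) := by
  have h00 : χ 0 ≠ 0 := by
    intro h
    have := hnorm.self_of_nhds
    simp [h] at this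
  have h0 : χ 0 = 1 := by
    have := hmul.self_of_nhds
    simp only [Prod.fst_zero, Prod.snd_zero, add_zero] at this
    exact (mul_eq_left₀ h00).mp this.symm
  have harg : ContinuousAt (fun h => (χ h).arg) 0 :=
    ContinuousAt.comp (g := Complex.arg) (Complex.continuousAt_arg (by simp [h0])) hχ
  -- Two arguments below π/2 add without wrapping around, so `arg` is locally additive.
  have hsmall : ∀ᶠ h in 𝓝 (0 : E), |(χ h).arg| < Real.pi / 2 := by
    have := harg.tendsto.abs
    simp only [h0, Complex.arg_one, abs_zero] at this
    exact this.eventually_lt_const (by positivity)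
  obtain ⟨r₁, hr₁, h₁⟩ := Metric.eventually_nhds_iff.mp (hnorm.and hsmall)
  obtain ⟨r₂, hr₂, h₂⟩ := Metric.eventually_nhds_iff.mp hmul
  simp only [dist_zero_right] at h₁ h₂
  obtain ⟨M, hM⟩ := exists_clm_eq_of_locally_additive (L := fun h => (χ h).arg)
    (lt_min hr₁ hr₂) harg (fun h k hh hk => by
      have hh' := hh.trans_le (min_le_left _ _)
      have hk' := hk.trans_le (min_le_left _ _)
      have e := @h₂ (h, k) (by
        rw [Prod.norm_def]
        exact max_lt (hh.trans_le (min_le_right _ _)) (hk.trans_le (min_le_right _ _)))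
      simp only at e ⊢
      rw [e]
      have a1 := abs_lt.mp (h₁ hh').2
      have a2 := abs_lt.mp (h₁ hk').2
      refine Complex.arg_mul ?_ ?_ ⟨by linarith, by linarith⟩
      · intro h
        simpa [h] using (h₁ hh').1
      · intro h
        simpa [h] using (h₁ hk').1)
  refine ⟨(InnerProductSpace.toDual ℝ E).symm M, ?_⟩
  filter_upwards [Metric.ball_mem_nhds (0 : E) (lt_min hr₁ hr₂)] with h hh
  have hh : ‖h‖ < min r₁ r₂ := by simpa using hh
  rw [InnerProductSpace.toDual_symm_apply, ← hM h hh]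
  have := Complex.norm_mul_exp_arg_mul_I (χ h)
  rw [(h₁ (hh.trans_le (min_le_left _ _))).1, Complex.ofReal_one, one_mul] at this
  rw [mul_comm, this]

/-- If the phase of `F t * F (x - t)` depends only on `x` and `F` has preconnected support, then the
phase of `F` is affine. -/
theorem exists_eq_exp_mul_norm_of_phase {F : E → ℂ} (hF : Continuous F)
    (hconn : IsPreconnected {ξ | 0 < ‖F ξ‖})
    (hphase : ∀ x s t, F t * F (x - t) * ‖F s * F (x - s)‖ = F s * F (x - s) * ‖F t * F (x - t)‖) :
    ∃ (α : ℝ) (β : E), ∀ ξ,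
      F ξ = Complex.exp (Complex.I * ((α + ⟪β, ξ⟫ : ℝ) : ℂ)) * (‖F ξ‖ : ℂ) := by
  rcases Set.eq_empty_or_nonempty {ξ | 0 < ‖F ξ‖} with hemp | ⟨a, ha⟩
  · refine ⟨0, 0, fun ξ => ?_⟩
    have : ¬ 0 < ‖F ξ‖ := fun h => (Set.ext_iff.mp hemp ξ).mp h
    simp at this
    simp [this]
  have hne (b : E) : b ∈ {ξ | 0 < ‖F ξ‖} ↔ F b ≠ 0 := norm_pos_iff
  set u : E → ℂ := fun ξ => F ξ / ‖F ξ‖ with hu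
  have hu1 (b : E) (hb : F b ≠ 0) : ‖u b‖ = 1 := by simp [hu, hb]
  have hu0 (b : E) (hb : F b ≠ 0) : u b ≠ 0 := by simp [hu, hb]
  have hev (b : E) (hb : F b ≠ 0) : ∀ᶠ h in 𝓝 (0 : E), F (b + h) ≠ 0 := by
    have : ContinuousAt (fun h => F (b + h)) 0 := by fun_prop
    exact this.eventually_ne (by simpa)
  have huu (a b h : E) (ha : F a ≠ 0) (hb : F b ≠ 0) (hah : F (a + h) ≠ 0)
      (hbh : F (b + h) ≠ 0) : u (b + h) * u a = u b * u (a + h) := by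
    -- The pairs (b + h, a) and (b, a + h) have the same sum.
    have := hphase (a + b + h) b (b + h)
    rw [show a + b + h - (b + h) = a by abel, show a + b + h - b = a + h by abel,
      norm_mul, norm_mul] at this
    have n1 : (‖F a‖ : ℂ) ≠ 0 := by simpa using ha
    have n2 : (‖F b‖ : ℂ) ≠ 0 := by simpa using hb
    have n3 : (‖F (a + h)‖ : ℂ) ≠ 0 := by simpa using hah
    have n4 : (‖F (b + h)‖ : ℂ) ≠ 0 := by simpa using hbh
    push_cast at this
    simp only [hu]
    rw [div_mul_div_comm, div_mul_div_comm, div_eq_div_iff (by positivity) (by positivity)]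
    exact this
  rw [hne] at ha
  obtain ⟨β, hβ⟩ := exists_eq_exp_inner_of_locally_multiplicative (χ := fun h => u (a + h) / u a)
    (by
      have : (‖F a‖ : ℂ) ≠ 0 := by simpa using ha
      refine ContinuousAt.div_const (ContinuousAt.div (by fun_prop) (by fun_prop) (by simpa)) _)
    (by
      filter_upwards [hev a ha] with h hh
      rw [norm_div, hu1 _ hh, hu1 _ ha, div_one])
    (by
      have t1 : Tendsto (fun z : E × E => z.1) (𝓝 0) (𝓝 0) := continuous_fst.tendsto _
      have t2 : Tendsto (fun z : E × E => z.2) (𝓝 0) (𝓝 0) := continuous_snd.tendsto _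
      have t3 : Tendsto (fun z : E × E => z.1 + z.2) (𝓝 0) (𝓝 0) := by simpa using t1.add t2
      filter_upwards [t1.eventually (hev a ha), t2.eventually (hev a ha),
        t3.eventually (hev a ha)] with z h1 h2 h3
      rw [← add_assoc] at h3 ⊢
      have := huu a (a + z.1) z.2 ha h1 h2 h3
      have := hu0 a ha
      field_simp
      assumption)
  set w : E → ℂ := fun ξ => u ξ * Complex.exp (-(Complex.I * (⟪β, ξ⟫ : ℝ))) with hw
  have hwc : ∀ b, F b ≠ 0 → w b = w a := by
    intro b hb
    -- `huu` transports the character found at a to any x in the support, so w is locally constant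
    -- there.
    refine hconn.induction₂ (fun x y => w y = w x) (fun x hx => ?_)
      (fun x y z _ _ _ h1 h2 => h2.trans h1) (fun x y _ _ h => h.symm)
      ((hne a).mpr ha) ((hne b).mpr hb)
    rw [hne] at hx
    have tx : Tendsto (fun y => y - x) (𝓝[{ξ | 0 < ‖F ξ‖}] x) (𝓝 0) := by
      have : Tendsto (fun y => y - x) (𝓝 x) (𝓝 0) := by
        simpa using (continuous_sub_right x).tendsto x
      exact this.mono_left nhdsWithin_le_nhds
    filter_upwards [tx.eventually hβ, tx.eventually (hev x hx), tx.eventually (hev a ha)]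
      with y h1 h2 h3
    have e := huu a x (y - x) ha hx h3 h2
    have h0 := hu0 a ha
    rw [div_eq_iff h0] at h1
    rw [h1, add_sub_cancel, ← mul_assoc] at e
    have e' := mul_right_cancel₀ h0 e
    simp only [hw]
    rw [e', mul_assoc, ← Complex.exp_add]
    congr 2
    rw [inner_sub_right]
    push_cast
    ring
  refine ⟨(w a).arg, β, fun ξ => ?_⟩
  by_cases hξ : F ξ = 0
  · simp [hξ]
  have hwa : ‖w a‖ = 1 := by
    rw [hw, norm_mul, hu1 a ha, one_mul, Complex.norm_exp]
    simp
  have e := hwc ξ hξ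
  have := Complex.norm_mul_exp_arg_mul_I (w a)
  rw [hwa, Complex.ofReal_one, one_mul] at this
  push_cast
  rw [mul_add, Complex.exp_add, mul_comm Complex.I, this, ← e, hw]
  simp only
  rw [mul_assoc (u ξ), ← Complex.exp_add, neg_add_cancel, Complex.exp_zero, mul_one, hu]
  simp only
  rw [div_mul_cancel₀ _ (by simpa using hξ)]

end LocalCharacter

/-! ### Equality in the triangle inequality for integrals. -/

section ConstantPhase

open Filter Topology

/-- A continuous function for which the triangle inequality for integrals is an equality has
constant phase. -/
theorem exists_eq_mul_norm_of_lintegral_enorm_le {X : Type*} [TopologicalSpace X]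
    [MeasurableSpace X] [OpensMeasurableSpace X] {μ : Measure X} [μ.IsOpenPosMeasure]
    {h : X → ℂ} (hc : Continuous h) (hi : Integrable h μ)
    (hle : ∫⁻ t, ‖h t‖ₑ ∂μ ≤ ‖∫ t, h t ∂μ‖ₑ) :
    ∃ α : ℝ, ∀ t, h t = Complex.exp (Complex.I * α) * (‖h t‖ : ℂ) := by
  set J := ∫ t, h t ∂μ with hJ
  refine ⟨J.arg, ?_⟩
  set c := Complex.exp (Complex.I * J.arg) with hcdef
  set c' := Complex.exp (-(Complex.I * J.arg)) with hc'def
  have hcc : c * c' = 1 := by rw [hcdef, hc'def, ← Complex.exp_add, add_neg_cancel, Complex.exp_zero]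
  have hc1 : ‖c'‖ = 1 := by rw [hc'def, Complex.norm_exp]; simp
  have hJc : c' * J = ‖J‖ := by
    have := Complex.norm_mul_exp_arg_mul_I J
    rw [mul_comm (J.arg : ℂ)] at this
    calc c' * J = (c * c') * ‖J‖ := by
          conv_lhs => rw [← this]
          ring
      _ = _ := by rw [hcc, one_mul]
  have hn : ∫ t, ‖h t‖ ∂μ ≤ ‖J‖ := by
    rw [integral_norm_eq_lintegral_enorm hi.aestronglyMeasurable, ← toReal_enorm J]
    exact ENNReal.toReal_mono enorm_ne_top hle
  have hre (t : X) : (c' * h t).re ≤ ‖h t‖ := by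
    calc _ ≤ ‖c' * h t‖ := Complex.re_le_norm _
      _ = _ := by rw [norm_mul, hc1, one_mul]
  have hi' : Integrable (fun t => c' * h t) μ := hi.const_mul c'
  have hire : Integrable (fun t => (c' * h t).re) μ := hi'.re
  -- After rotation by the phase of J, the integrand is nonnegative with zero integral; being
  -- continuous, it vanishes everywhere.
  have hint : ∫ t, (‖h t‖ - (c' * h t).re) ∂μ = 0 := by
    refine le_antisymm ?_ (integral_nonneg fun t => sub_nonneg.mpr (hre t))
    rw [integral_sub hi.norm hire]
    have : ∫ t, (c' * h t).re ∂μ = ‖J‖ := by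
      have := integral_re hi'
      simp only [RCLike.re_to_complex] at this
      rw [this, integral_const_mul, ← hJ, hJc, Complex.ofReal_re]
    rw [this]
    linarith
  rw [integral_eq_zero_iff_of_nonneg (fun t => sub_nonneg.mpr (hre t)) (hi.norm.sub hire)] at hint
  have hev := (Continuous.ae_eq_iff_eq μ
    (hc.norm.sub (Complex.continuous_re.comp (continuous_const.mul hc))) continuous_const).mp hint
  intro t
  have ht : (c' * h t).re = ‖c' * h t‖ := by
    have : ‖h t‖ - (c' * h t).re = 0 := congrFun hev t
    rw [norm_mul, hc1, one_mul]
    linarith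
  have ht' : c' * h t = ‖h t‖ := by
    rw [Complex.re_eq_norm] at ht
    have := Complex.eq_coe_norm_of_nonneg ht
    rwa [norm_mul, hc1, one_mul] at this
  rw [← ht', ← mul_assoc, hcc, one_mul]

end ConstantPhase

/-! ### Plancherel and Hausdorff–Young for even exponents. -/

section HausdorffYoung

open Filter Topology

variable {E : Type*} [NormedAddCommGroup E] [InnerProductSpace ℝ E] [FiniteDimensional ℝ E]
  [MeasurableSpace E] [BorelSpace E]

theorem ae_eq_of_toTemperedDistribution_eq {q r : ℝ≥0∞} [Fact (1 ≤ q)] [Fact (1 ≤ r)]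
    {U : Lp ℂ q (volume : Measure E)} {V : Lp ℂ r (volume : Measure E)}
    (h : (U : 𝓢'(E, ℂ)) = (V : 𝓢'(E, ℂ))) : U =ᵐ[volume] V := by
  have hU := (Lp.memLp U).locallyIntegrable Fact.out
  have hV := (Lp.memLp V).locallyIntegrable Fact.out
  refine ae_eq_of_integral_contDiff_smul_eq hU hV fun g g_smooth g_cpt => ?_
  have hg₁ : HasCompactSupport (Complex.ofRealCLM ∘ g) := g_cpt.comp_left rfl
  have hg₂ : ContDiff ℝ ((⊤ : ℕ∞) : WithTop ℕ∞) (Complex.ofRealCLM ∘ g) := by fun_prop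
  have := DFunLike.congr_fun h (hg₁.toSchwartzMap hg₂)
  simpa using this

theorem continuous_fourierInv {F : E → ℂ} (hF : Integrable F) : Continuous (𝓕⁻ F) := by
  rw [← Real.Lp.fourierTransformInv_toLp (memLp_one_iff_integrable.mpr hF)]
  exact (Real.Lp.fourierTransformInv _).continuous

theorem norm_fourierInv_le (F : E → ℂ) (x : E) : ‖𝓕⁻ F x‖ ≤ ∫ t, ‖F t‖ := by
  rw [Real.fourierInv_eq]
  refine (norm_integral_le_integral_norm _).trans (le_of_eq ?_)
  simp_rw [Circle.norm_smul]

theorem memLp_top_fourierInv {F : E → ℂ} (hF : Integrable F) :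
    MemLp (𝓕⁻ F) ∞ (volume : Measure E) :=
  memLp_top_of_bound (continuous_fourierInv hF).aestronglyMeasurable (∫ t, ‖F t‖)
    (Eventually.of_forall (norm_fourierInv_le F))

/-- If an integrable function lies in `L^q`, its distributional inverse Fourier transform is given
by the inverse Fourier integral. -/
theorem fourierInv_toTemperedDistribution_eq_of_ae_eq {q r : ℝ≥0∞} [Fact (1 ≤ q)] [Fact (1 ≤ r)]
    {F : E → ℂ} (hF : Integrable F) {U : Lp ℂ q (volume : Measure E)} (hU : U =ᵐ[volume] F)
    {V : Lp ℂ r (volume : Measure E)} (hV : V =ᵐ[volume] 𝓕⁻ F) :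
    (V : 𝓢'(E, ℂ)) = 𝓕⁻ (U : 𝓢'(E, ℂ)) := by
  ext φ
  rw [TemperedDistribution.fourierInv_apply, Lp.toTemperedDistribution_apply,
    Lp.toTemperedDistribution_apply]
  have h1 : ∫ x, φ x • V x = ∫ x, 𝓕⁻ F x • φ x := by
    refine integral_congr_ae ?_
    filter_upwards [hV] with x hx
    rw [hx, smul_eq_mul, smul_eq_mul, mul_comm]
  have h2 : ∫ x, (𝓕⁻ φ) x • U x = ∫ x, F x • (𝓕⁻ (φ : E → ℂ)) x := by
    refine integral_congr_ae ?_
    filter_upwards [hU] with x hx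
    rw [hx, smul_eq_mul, smul_eq_mul, mul_comm, SchwartzMap.fourierInv_coe]
  rw [h1, h2]
  have hflip : (-innerₗ E).flip = -innerₗ E := by
    ext x y
    simp [real_inner_comm]
  have := VectorFourier.integral_fourierIntegral_smul_eq_flip (L := -innerₗ E)
    (μ := volume) (ν := volume) Real.continuous_fourierChar (by
      simp only [LinearMap.neg_apply, innerₗ_apply_apply]; fun_prop) hF (φ.integrable (μ := volume))
  rw [hflip] at this
  exact this

/-- Plancherel for the Fourier integral: it agrees as a distribution, hence a.e., with the L²
transform. -/
theorem eLpNorm_two_fourierInv {F : E → ℂ} (h1 : Integrable F) (h2 : MemLp F 2 volume) :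
    eLpNorm (𝓕⁻ F) 2 volume = eLpNorm F 2 volume := by
  have hV := (memLp_top_fourierInv h1).coeFn_toLp
  have hU := h2.coeFn_toLp
  have e := fourierInv_toTemperedDistribution_eq_of_ae_eq h1 hU hV
  rw [Lp.fourierInv_toTemperedDistribution_eq] at e
  have ae := ae_eq_of_toTemperedDistribution_eq e
  rw [← eLpNorm_congr_ae hV, eLpNorm_congr_ae ae, ← eLpNorm_congr_ae hU, ← Lp.enorm_def,
    ← Lp.enorm_def, ← ofReal_norm, ← ofReal_norm]
  congr 1
  have := Lp.norm_fourier_eq (𝓕⁻ (h2.toLp F))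
  rw [← this, FourierTransform.fourier_fourierInv_eq]

theorem integrable_convPow {F : E → ℂ} (hF : Integrable F) (k : ℕ) : Integrable (convPow F k) := by
  induction k with
  | zero => exact hF
  | succ k ih => exact hF.integrable_convolution (ContinuousLinearMap.mul ℂ ℂ) ih

theorem fourierInv_convPow {F : E → ℂ} (hF : Integrable F) (k : ℕ) (x : E) :
    𝓕⁻ (convPow F k) x = 𝓕⁻ F x ^ (k + 1) := by
  induction k with
  | zero => simp [convPow]
  | succ k ih =>
    have := Real.fourier_mul_convolution_eq hF (integrable_convPow hF k) (-x)
    rw [pow_succ', ← ih, Real.fourierInv_eq_fourier_neg F,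
      Real.fourierInv_eq_fourier_neg (convPow F k), ← this, Real.fourierInv_eq_fourier_neg]
    rfl

/-- The relation between the exponents `p = 2 (k + 1)` and its conjugate. -/
theorem toReal_conjExponent {k : ℕ} {p p' : ℝ≥0∞} (hp : p = ((2 * (k + 1) : ℕ) : ℝ≥0∞))
    (hpp' : p⁻¹ + p'⁻¹ = 1) :
    p' ≠ 0 ∧ p' ≠ ∞ ∧ 1 / (1 - 1 / (2 * (k + 1) : ℝ)) = p'.toReal := by
  have h0 : p' ≠ 0 := by
    rintro rfl
    simp at hpp'
  have hk : (0 : ℝ) ≤ k := k.cast_nonneg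
  have ht : p' ≠ ∞ := by
    rintro rfl
    simp only [ENNReal.inv_top, add_zero, ENNReal.inv_eq_one] at hpp'
    rw [hpp'] at hp
    have : (1 : ℕ) = 2 * (k + 1) := by exact_mod_cast hp
    lia
  refine ⟨h0, ht, ?_⟩
  have := congrArg ENNReal.toReal hpp'
  rw [ENNReal.toReal_add (by simp [hp]) (by simpa), ENNReal.toReal_inv, ENNReal.toReal_inv, hp,
    ENNReal.toReal_natCast] at this
  push_cast [ENNReal.toReal_one] at this
  rw [one_div (2 * (k + 1 : ℝ)), ← eq_sub_of_add_eq' this, one_div, inv_inv]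

variable {k : ℕ} {p p' : ℝ≥0∞}

/-- With c = 1/p, (k + 1)c = 1/2, so iterated Young lands exactly in L². -/
theorem eLpNorm_lconvPow_le {G : E → ℝ≥0∞} (hG : Measurable G)
    (hp : p = ((2 * (k + 1) : ℕ) : ℝ≥0∞)) (hpp' : p⁻¹ + p'⁻¹ = 1) :
    eLpNorm (lconvPow G k) 2 volume ≤ eLpNorm G p' volume ^ (k + 1) := by
  obtain ⟨h0, ht, he⟩ := toReal_conjExponent hp hpp'
  have hk : (0 : ℝ) ≤ k := k.cast_nonneg
  have hc : (0 : ℝ) < 1 / (2 * (k + 1)) := by positivity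
  have hkc : (k + 1) * (1 / (2 * (k + 1) : ℝ)) = 1 / 2 := by field_simp
  have h := lintegral_lconvPow_rpow_le hG hc k (by rw [hkc]; norm_num)
  rw [hkc, he, show 1 - 1 / (2 * (k + 1 : ℝ)) = 1 / p'.toReal by rw [← he, one_div_one_div]] at h
  rw [eLpNorm_eq_lintegral_rpow_enorm_toReal h0 ht,
    eLpNorm_eq_lintegral_rpow_enorm_toReal (by simp) (by simp)]
  norm_num at h ⊢
  exact h

theorem lconvPow_lt_top_ae_of_conj {G : E → ℝ≥0∞} (hG : Measurable G)
    (hp : p = ((2 * (k + 1) : ℕ) : ℝ≥0∞)) (hpp' : p⁻¹ + p'⁻¹ = 1)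
    (hfin : eLpNorm G p' volume < ∞) : ∀ j ≤ k, ∀ᵐ x, lconvPow G j x < ∞ := by
  intro j hj
  obtain ⟨h0, ht, he⟩ := toReal_conjExponent hp hpp'
  have hk : (0 : ℝ) ≤ k := k.cast_nonneg
  refine lconvPow_lt_top_ae hG (c := 1 / (2 * (k + 1))) (by positivity) j ?_ ?_
  · have : (j : ℝ) ≤ k := by exact_mod_cast hj
    rw [mul_one_div, div_lt_one (by positivity)]
    linarith
  · rw [he]
    simpa using lintegral_rpow_enorm_lt_top_of_eLpNorm_lt_top h0 ht hfin

theorem eLpNorm_convPow_le {F : E → ℂ} (hF : Measurable F)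
    (hp : p = ((2 * (k + 1) : ℕ) : ℝ≥0∞)) (hpp' : p⁻¹ + p'⁻¹ = 1) :
    eLpNorm (convPow F k) 2 volume ≤ eLpNorm F p' volume ^ (k + 1) := by
  refine (eLpNorm_mono_enorm (g := lconvPow (fun y => ‖F y‖ₑ) k) fun x => ?_).trans
    ((eLpNorm_lconvPow_le hF.enorm hp hpp').trans_eq ?_)
  · simpa using enorm_convPow_le F k x
  · rw [eLpNorm_enorm]

/-- The evenness of p enters here: |𝓕⁻ F|^p is the square of |𝓕⁻ F|^(k+1), to which the convolution
theorem and Plancherel apply. -/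
theorem eLpNorm_fourierInv_pow {F : E → ℂ} (hF : Measurable F) (h1 : Integrable F)
    (hFp : MemLp F p' volume)
    (hp : p = ((2 * (k + 1) : ℕ) : ℝ≥0∞)) (hpp' : p⁻¹ + p'⁻¹ = 1) :
    eLpNorm (𝓕⁻ F) p volume ^ (k + 1) = eLpNorm (convPow F k) 2 volume := by
  have h2 : MemLp (convPow F k) 2 volume :=
    ⟨(stronglyMeasurable_convPow hF k).aestronglyMeasurable,
      (eLpNorm_convPow_le hF hp hpp').trans_lt (ENNReal.pow_lt_top hFp.2)⟩
  rw [← eLpNorm_two_fourierInv (integrable_convPow h1 k) h2, hp,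
    eLpNorm_eq_lintegral_rpow_enorm_toReal (by simp) (ENNReal.natCast_ne_top _),
    eLpNorm_eq_lintegral_rpow_enorm_toReal (by simp) (by simp), ← ENNReal.rpow_natCast,
    ← ENNReal.rpow_mul]
  simp only [fourierInv_convPow h1, enorm_pow]
  have hk : (0 : ℝ) ≤ k := k.cast_nonneg
  congr 1
  · refine lintegral_congr fun x => ?_
    rw [← ENNReal.rpow_natCast, ← ENNReal.rpow_mul, ENNReal.toReal_natCast]
    push_cast [ENNReal.toReal_ofNat]
    ring_nf
  · rw [ENNReal.toReal_natCast]
    push_cast [ENNReal.toReal_ofNat]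
    field_simp

theorem memLp_fourierInv {F : E → ℂ} (hF : Measurable F) (h1 : Integrable F)
    (hFp : MemLp F p' volume)
    (hp : p = ((2 * (k + 1) : ℕ) : ℝ≥0∞)) (hpp' : p⁻¹ + p'⁻¹ = 1) :
    MemLp (𝓕⁻ F) p volume ∧ eLpNorm (𝓕⁻ F) p volume ≤ eLpNorm F p' volume := by
  have h : eLpNorm (𝓕⁻ F) p volume ≤ eLpNorm F p' volume := by
    rw [← ENNReal.pow_le_pow_left_iff k.succ_ne_zero, eLpNorm_fourierInv_pow hF h1 hFp hp hpp']
    exact eLpNorm_convPow_le hF hp hpp'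
  exact ⟨⟨(continuous_fourierInv h1).aestronglyMeasurable, h.trans_lt hFp.2⟩, h⟩

theorem fourierInv_sub {F G : E → ℂ} (hF : Integrable F) (hG : Integrable G) :
    𝓕⁻ (F - G) = 𝓕⁻ F - 𝓕⁻ G := by
  ext x
  simp only [Real.fourierInv_eq_fourier_neg, Pi.sub_apply, Real.fourier_eq, smul_sub]
  exact integral_sub ((Real.fourierIntegral_convergent_iff _).mpr hF)
    ((Real.fourierIntegral_convergent_iff _).mpr hG)

/-- **Hausdorff-Young** for an even exponent `p = 2 (k + 1)`, with the exact value of the norm. -/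
theorem exists_Lp_eq_fourierInv [Fact (1 ≤ p)] [Fact (1 ≤ p')] {F : E → ℂ} (hF : Measurable F)
    (hp : p = ((2 * (k + 1) : ℕ) : ℝ≥0∞)) (hpp' : p⁻¹ + p'⁻¹ = 1)
    {U : Lp ℂ p' (volume : Measure E)} (hU : U =ᵐ[volume] F) :
    ∃ u : Lp ℂ p (volume : Measure E), (u : 𝓢'(E, ℂ)) = 𝓕⁻ (U : 𝓢'(E, ℂ)) ∧
      ‖u‖ₑ ^ (k + 1) = eLpNorm (convPow F k) 2 volume := by
  obtain ⟨h0, ht, -⟩ := toReal_conjExponent hp hpp'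
  have hFp : MemLp F p' volume := (memLp_congr_ae hU).mp (Lp.memLp U)
  have hUF : U = hFp.toLp F := Lp.ext (hU.trans hFp.coeFn_toLp.symm)
  -- F need not be integrable; simple functions in L^{p'} are, and the bound for integrable
  -- functions makes their inverse transforms Cauchy in L^p.
  set S : ℕ → SimpleFunc E ℂ := fun n =>
    SimpleFunc.approxOn F hF (Set.range F ∪ {0}) 0 (by simp) n with hS
  have hSp (n : ℕ) : MemLp (S n) p' volume := SimpleFunc.memLp_approxOn_range hF hFp n
  have hS1 (n : ℕ) : Integrable (S n) :=
    (SimpleFunc.memLp_iff_integrable h0 ht).mp (hSp n)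
  have hSlim : Tendsto (fun n => (hSp n).toLp (S n)) atTop (𝓝 U) := by
    rw [hUF]
    exact SimpleFunc.tendsto_approxOn_range_Lp ht hF hFp
  have hv (n : ℕ) := (memLp_fourierInv (S n).measurable (hS1 n) (hSp n) hp hpp').1
  set v : ℕ → Lp ℂ p (volume : Measure E) := fun n => (hv n).toLp _ with hvdef
  have hvdist (n m : ℕ) : dist (v n) (v m) ≤ dist ((hSp n).toLp (S n)) ((hSp m).toLp (S m)) := by
    rw [Lp.dist_def, Lp.dist_def]
    have e1 : eLpNorm (⇑(v n) - ⇑(v m)) p volume = eLpNorm (𝓕⁻ (⇑(S n) - ⇑(S m))) p volume := by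
      rw [fourierInv_sub (hS1 n) (hS1 m)]
      exact eLpNorm_congr_ae ((hv n).coeFn_toLp.sub (hv m).coeFn_toLp)
    have e2 : eLpNorm (⇑((hSp n).toLp (S n)) - ⇑((hSp m).toLp (S m))) p' volume =
        eLpNorm (⇑(S n) - ⇑(S m)) p' volume :=
      eLpNorm_congr_ae ((hSp n).coeFn_toLp.sub (hSp m).coeFn_toLp)
    rw [e1, e2]
    have hd := (hSp n).sub (hSp m)
    exact ENNReal.toReal_mono hd.2.ne (memLp_fourierInv
      ((S n).measurable.sub (S m).measurable) ((hS1 n).sub (hS1 m)) hd hp hpp').2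
  have hvc : CauchySeq v := by
    have := hSlim.cauchySeq
    rw [Metric.cauchySeq_iff] at this ⊢
    intro ε hε
    obtain ⟨N, hN⟩ := this ε hε
    exact ⟨N, fun m hm n hn => (hvdist m n).trans_lt (hN m hm n hn)⟩
  obtain ⟨u, hu⟩ := cauchySeq_tendsto_of_complete hvc
  refine ⟨u, ?_, ?_⟩
  · have t1 : Tendsto (fun n => Lp.toTemperedDistributionCLM ℂ volume p (v n)) atTop
        (𝓝 (Lp.toTemperedDistributionCLM ℂ volume p u)) :=
      ((Lp.toTemperedDistributionCLM ℂ volume p).continuous.tendsto u).comp hu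
    have t2 : Tendsto (fun n => 𝓕⁻ (Lp.toTemperedDistributionCLM ℂ volume p'
        ((hSp n).toLp (S n)))) atTop
        (𝓝 (𝓕⁻ (Lp.toTemperedDistributionCLM ℂ volume p' U))) :=
      ((FourierTransform.fourierInvCLM ℂ 𝓢'(E, ℂ) ∘L
        Lp.toTemperedDistributionCLM ℂ volume p').continuous.tendsto U).comp hSlim
    refine tendsto_nhds_unique t1 (t2.congr fun n => ?_)
    exact (fourierInv_toTemperedDistribution_eq_of_ae_eq (hS1 n) (hSp n).coeFn_toLp
      (hv n).coeFn_toLp).symm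
  · have t1 : Tendsto (fun n => ‖v n‖ₑ ^ (k + 1)) atTop (𝓝 (‖u‖ₑ ^ (k + 1))) :=
      ((ENNReal.continuous_pow _).comp continuous_enorm).tendsto u |>.comp hu
    have t2 (n : ℕ) : ‖v n‖ₑ ^ (k + 1) = eLpNorm (convPow (S n) k) 2 volume := by
      rw [← eLpNorm_fourierInv_pow (S n).measurable (hS1 n) (hSp n) hp hpp', Lp.enorm_def,
        eLpNorm_congr_ae (hv n).coeFn_toLp]
    simp only [t2] at t1
    refine tendsto_nhds_unique t1 ?_
    -- The approximants satisfy |S n| ≤ |F| + |F|; this is the source of the factor 2.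
    set G : E → ℝ≥0∞ := fun x => ‖(2 : ℂ) * F x‖ₑ with hG
    have hGm : Measurable G := by fun_prop
    have hGp : eLpNorm G p' volume < ∞ := by
      rw [hG, eLpNorm_enorm]
      exact (hFp.const_mul 2).2
    have hle (n : ℕ) (x : E) : ‖S n x‖ₑ ≤ G x := by
      rw [hG, enorm_le_iff_norm_le, norm_mul, Complex.norm_two, two_mul]
      exact SimpleFunc.norm_approxOn_zero_le hF _ x n
    have hfin := lconvPow_lt_top_ae_of_conj hGm hp hpp' hGp
    have hpt := tendsto_convPow (fun n => (S n).measurable) hGm hle (fun x =>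
      SimpleFunc.tendsto_approxOn hF (by simp) (subset_closure (by simp))) k hfin
    have hN := (eLpNorm_lconvPow_le hGm hp hpp').trans_lt (ENNReal.pow_lt_top hGp)
    have hN2 := lintegral_rpow_enorm_lt_top_of_eLpNorm_lt_top (by simp) (by simp) hN
    simp only [eLpNorm_eq_lintegral_rpow_enorm_toReal (two_ne_zero (α := ℝ≥0∞))
      (ENNReal.ofNat_ne_top (n := 2))]
    refine (ENNReal.continuous_rpow_const.tendsto _).comp ?_
    refine tendsto_lintegral_of_dominated_convergence'
      (fun x => lconvPow G k x ^ (2 : ℝ≥0∞).toReal) (fun n => ?_) (fun n => ?_) ?_ ?_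
    · have := (stronglyMeasurable_convPow (S n).measurable k).measurable
      exact Measurable.aemeasurable (by fun_prop)
    · filter_upwards [lconvPow_mono_ae (Eventually.of_forall (hle n)) k] with x hx
      gcongr
      exact (enorm_convPow_le _ _ _).trans hx
    · simpa using hN2.ne
    · filter_upwards [hpt] with x hx
      exact (ENNReal.continuous_rpow_const.tendsto _).comp
        ((continuous_enorm.tendsto _).comp hx)

end HausdorffYoung

/-! ### The equality cases. -/

section Equality

open Filter Topology

variable {E : Type*} [NormedAddCommGroup E] [InnerProductSpace ℝ E] [FiniteDimensional ℝ E]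
  [MeasurableSpace E] [BorelSpace E]

/-- Equality of finite integrals forces a.e. equality of the dominated integrands F(t)·(power at x -
t). Freezing one t with G(t) ≠ 0 and cancelling G(t) removes a factor. -/
theorem lconvPow_le_enorm_convPow_of_succ {F : E → ℂ} {G : E → ℝ≥0∞} (hF : Measurable F)
    (hG : Measurable G) (hle : ∀ᵐ x, ‖F x‖ₑ ≤ G x) (hGtop : ∀ x, G x ≠ ∞)
    (hG0 : ¬ ∀ᵐ x, G x = 0) {k : ℕ} (hfin : ∀ᵐ x, lconvPow G (k + 1) x < ∞)
    (h : ∀ᵐ x, lconvPow G (k + 1) x ≤ ‖convPow F (k + 1) x‖ₑ) :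
    ∀ᵐ x, lconvPow G k x ≤ ‖convPow F k x‖ₑ := by
  have hm := measurable_lconvPow hG k
  have hmc := (stronglyMeasurable_convPow hF k).measurable
  have hCN : ∀ᵐ x, ‖convPow F k x‖ₑ ≤ lconvPow G k x := by
    filter_upwards [lconvPow_mono_ae hle k] with x hx
    exact (enorm_convPow_le F k x).trans hx
  have h1 : ∀ᵐ x, ∀ᵐ t, ‖F t‖ₑ * ‖convPow F k (x - t)‖ₑ = G t * lconvPow G k (x - t) := by
    filter_upwards [hfin, h] with x hx1 hx2
    have hpt : ∀ᵐ t, ‖F t‖ₑ * ‖convPow F k (x - t)‖ₑ ≤ G t * lconvPow G k (x - t) := by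
      filter_upwards [hle, ae_comp_sub_left hCN x] with t ht1 ht2
      gcongr
    refine ae_eq_of_ae_le_of_lintegral_le hpt ?_ (by fun_prop) ?_
    · exact ((lintegral_mono_ae hpt).trans_lt hx1).ne
    · refine hx2.trans ((enorm_integral_le_lintegral_enorm _).trans_eq ?_)
      simp only [enorm_mul]
  -- Exchanging quantifiers allows t to be fixed before x.
  have h2 := (Measure.ae_ae_comm
    (p := fun x t : E => ‖F t‖ₑ * ‖convPow F k (x - t)‖ₑ = G t * lconvPow G k (x - t))
    (measurableSet_eq_fun (by fun_prop) (by fun_prop))).mp h1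
  have hG0' : ∃ᶠ t in ae (volume : Measure E), G t ≠ 0 :=
    Filter.not_eventually.mp hG0
  obtain ⟨t, ht0, ht, htle⟩ := (hG0'.and_eventually (h2.and hle)).exists
  filter_upwards [(measurePreserving_add_right volume t).quasiMeasurePreserving.ae ht] with y hy
  rw [add_sub_cancel_right] at hy
  rw [← ENNReal.mul_le_mul_iff_right ht0 (hGtop t), ← hy]
  gcongr

theorem lconvPow_le_enorm_convPow_of_le {F : E → ℂ} {G : E → ℝ≥0∞} (hF : Measurable F)
    (hG : Measurable G) (hle : ∀ᵐ x, ‖F x‖ₑ ≤ G x) (hGtop : ∀ x, G x ≠ ∞)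
    (hG0 : ¬ ∀ᵐ x, G x = 0) {k : ℕ} (hfin : ∀ j ≤ k, ∀ᵐ x, lconvPow G j x < ∞)
    (h : ∀ᵐ x, lconvPow G k x ≤ ‖convPow F k x‖ₑ) {j : ℕ} (hj : j ≤ k) :
    ∀ᵐ x, lconvPow G j x ≤ ‖convPow F j x‖ₑ := by
  refine Nat.decreasingInduction' (P := fun j => ∀ᵐ x, lconvPow G j x ≤ ‖convPow F j x‖ₑ)
    (fun i hi _ hP => ?_) hj h
  exact lconvPow_le_enorm_convPow_of_succ hF hG hle hGtop hG0 (hfin (i + 1) hi) hP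

/-- For a.e. x the triangle inequality is an equality, so the phase in t is constant. The resulting
identity is closed in x, and a conull set is dense. -/
theorem phase_of_enorm_convPow_one {F : E → ℂ} (hF : Continuous F)
    (hfin : ∀ᵐ x, lconvPow (fun y => ‖F y‖ₑ) 1 x < ∞)
    (h : ∀ᵐ x, lconvPow (fun y => ‖F y‖ₑ) 1 x ≤ ‖convPow F 1 x‖ₑ) (x s t : E) :
    F t * F (x - t) * ‖F s * F (x - s)‖ = F s * F (x - s) * ‖F t * F (x - t)‖ := by
  have hae : ∀ᵐ x, ∀ s t,
      F t * F (x - t) * ‖F s * F (x - s)‖ = F s * F (x - s) * ‖F t * F (x - t)‖ := by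
    filter_upwards [hfin, h] with x hx1 hx2 s t
    have hc : Continuous fun t => F t * F (x - t) := by fun_prop
    have hl : ∫⁻ t, ‖F t * F (x - t)‖ₑ = lconvPow (fun y => ‖F y‖ₑ) 1 x := by
      simp only [lconvPow, enorm_mul]
    obtain ⟨α, hα⟩ := exists_eq_mul_norm_of_lintegral_enorm_le hc
      ⟨hc.aestronglyMeasurable, hl.trans_lt hx1⟩ (hl.trans_le hx2)
    linear_combination (‖F s * F (x - s)‖ : ℂ) * hα t - (‖F t * F (x - t)‖ : ℂ) * hα s
  have hcl : IsClosed {x | F t * F (x - t) * ‖F s * F (x - s)‖ =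
      F s * F (x - s) * ‖F t * F (x - t)‖} :=
    isClosed_eq (by fun_prop) (by fun_prop)
  have hd := Measure.dense_of_ae (hae.mono fun x hx => hx s t)
  exact Set.eq_univ_iff_forall.mp (hcl.closure_eq ▸ hd.closure_eq) x

/-- Degenerate case, in which the descent has no t with G(t) ≠ 0 to freeze. -/
theorem exists_phase_of_ae_eq_zero {F : E → ℂ} {G : E → ℝ≥0∞} (hF : Continuous F)
    (hle : ∀ᵐ x, ‖F x‖ₑ ≤ G x) (hG0 : ∀ᵐ x, G x = 0) :
    ∃ (α : ℝ) (β : E), (∀ ξ, F ξ = Complex.exp (Complex.I * ((α + ⟪β, ξ⟫ : ℝ) : ℂ)) * (‖F ξ‖ : ℂ)) ∧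
      ∀ᵐ ξ, ‖F ξ‖ₑ = G ξ := by
  have h : F =ᵐ[volume] fun _ => 0 := by
    filter_upwards [hle, hG0] with x h1 h2
    simpa [h2] using h1
  have h' := (Continuous.ae_eq_iff_eq _ hF continuous_const).mp h
  refine ⟨0, 0, fun ξ => by simp [h'], ?_⟩
  filter_upwards [hG0] with x hx
  simp [h', hx]

theorem ae_eq_exp_mul_of_phase {F : E → ℂ} {G : E → ℝ≥0∞} {α : ℝ} {β : E}
    (h : ∀ ξ, F ξ = Complex.exp (Complex.I * ((α + ⟪β, ξ⟫ : ℝ) : ℂ)) * (‖F ξ‖ : ℂ))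
    (hG : ∀ᵐ ξ, ‖F ξ‖ₑ = G ξ) :
    ∀ᵐ ξ, F ξ = Complex.exp (Complex.I * ((α + ⟪β, ξ⟫ : ℝ) : ℂ)) * ((G ξ).toReal : ℂ) := by
  filter_upwards [hG] with ξ hξ
  rw [← hξ, toReal_enorm]
  exact h ξ

theorem enorm_ofReal_toReal {a : ℝ≥0∞} (ha : a ≠ ∞) : ‖(a.toReal : ℂ)‖ₑ = a := by
  rw [← ofReal_norm, Complex.norm_real, Real.norm_of_nonneg ENNReal.toReal_nonneg,
    ENNReal.ofReal_toReal ha]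

/-- The equality case for an even exponent. -/
theorem eLpNorm_convPow_eq_iff {k : ℕ} (hk : 1 ≤ k) {p p' : ℝ≥0∞}
    (hp : p = ((2 * (k + 1) : ℕ) : ℝ≥0∞)) (hpp' : p⁻¹ + p'⁻¹ = 1)
    {F : E → ℂ} {G : E → ℝ≥0∞} (hF : Continuous F) (hG : Measurable G)
    (hle : ∀ᵐ x, ‖F x‖ₑ ≤ G x) (hGtop : ∀ x, G x ≠ ∞) (hGp : eLpNorm G p' volume < ∞)
    (hconn : IsPreconnected {ξ | 0 < ‖F ξ‖}) :
    eLpNorm (convPow F k) 2 volume =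
        eLpNorm (convPow (fun y => ((G y).toReal : ℂ)) k) 2 volume ↔
      ∃ (α : ℝ) (β : E),
        (∀ ξ, F ξ = Complex.exp (Complex.I * ((α + ⟪β, ξ⟫ : ℝ) : ℂ)) * (‖F ξ‖ : ℂ)) ∧
        ∀ᵐ ξ, ‖F ξ‖ₑ = G ξ := by
  have hfin := lconvPow_lt_top_ae_of_conj hG hp hpp' hGp
  constructor
  · intro heq
    by_cases hG0 : ∀ᵐ x, G x = 0
    · exact exists_phase_of_ae_eq_zero hF hle hG0
    have hFm := hF.measurable
    have hCle : ∀ᵐ x, ‖convPow F k x‖ₑ ≤ lconvPow G k x := by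
      filter_upwards [lconvPow_mono_ae hle k] with x hx
      exact (enorm_convPow_le F k x).trans hx
    have hGN : eLpNorm (convPow (fun y => ((G y).toReal : ℂ)) k) 2 volume =
        eLpNorm (lconvPow G k) 2 volume := by
      refine eLpNorm_congr_enorm_ae ?_
      filter_upwards [hfin k le_rfl] with x hx
      rw [convPow_ofReal_toReal hG k hfin, enorm_eq_self, enorm_ofReal_toReal hx.ne]
    rw [hGN, eLpNorm_eq_lintegral_rpow_enorm_toReal (by simp) (by simp),
      eLpNorm_eq_lintegral_rpow_enorm_toReal (by simp) (by simp)] at heq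
    have heq' := ENNReal.rpow_left_injective (by simp) heq
    have hN2 := lintegral_rpow_enorm_lt_top_of_eLpNorm_lt_top (by simp) (by simp)
      ((eLpNorm_lconvPow_le hG hp hpp').trans_lt (ENNReal.pow_lt_top hGp))
    simp only [enorm_eq_self] at heq' hN2
    have hm := measurable_lconvPow hG k
    have hae := ae_eq_of_ae_le_of_lintegral_le (μ := (volume : Measure E))
      (f := fun x => ‖convPow F k x‖ₑ ^ (2 : ℝ≥0∞).toReal)
      (g := fun x => lconvPow G k x ^ (2 : ℝ≥0∞).toReal)
      (by filter_upwards [hCle] with x hx; gcongr) (heq'.trans_lt hN2).ne (by fun_prop) heq'.ge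
    have hk' : ∀ᵐ x, lconvPow G k x ≤ ‖convPow F k x‖ₑ := by
      filter_upwards [hae] with x hx
      exact (ENNReal.rpow_left_injective (by simp) hx).ge
    -- Index 0 yields the modulus and index 1 the phase; the latter is available because k ≥ 1, i.e.
    -- p ≥ 4.
    have h0 := lconvPow_le_enorm_convPow_of_le hFm hG hle hGtop hG0 hfin hk' (Nat.zero_le k)
    have h1 := lconvPow_le_enorm_convPow_of_le hFm hG hle hGtop hG0 hfin hk' hk
    have hFG : ∀ᵐ ξ, ‖F ξ‖ₑ = G ξ := by
      filter_upwards [hle, h0] with x hx1 hx2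
      exact le_antisymm hx1 hx2
    have hmono := lconvPow_mono_ae hle 1
    obtain ⟨α, β, h⟩ := exists_eq_exp_mul_norm_of_phase hF hconn
      (phase_of_enorm_convPow_one hF
        (by filter_upwards [hmono, hfin 1 hk] with x hx1 hx2; exact hx1.trans_lt hx2)
        (by filter_upwards [hmono, h1] with x hx1 hx2; exact hx1.trans hx2))
    exact ⟨α, β, h, hFG⟩
  · rintro ⟨α, β, h, hFG⟩
    refine eLpNorm_congr_norm_ae ?_
    filter_upwards [convPow_congr_ae (ae_eq_exp_mul_of_phase h hFG) k] with x hx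
    rw [hx, convPow_modulation, norm_mul, mul_comm Complex.I, Complex.norm_exp_ofReal_mul_I,
      one_mul]

theorem enorm_le_eLpNorm_top {h : E → ℂ} (hc : Continuous h) (x : E) :
    ‖h x‖ₑ ≤ eLpNorm h ∞ (volume : Measure E) := by
  have hcl : IsClosed {x | ‖h x‖ₑ ≤ eLpNorm h ∞ (volume : Measure E)} :=
    isClosed_le (by fun_prop) continuous_const
  have hd : Dense {x | ‖h x‖ₑ ≤ eLpNorm h ∞ (volume : Measure E)} :=
    Measure.dense_of_ae (μ := volume) (by
      rw [eLpNorm_exponent_top]; exact ae_le_eLpNormEssSup)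
  exact Set.eq_univ_iff_forall.mp (hcl.closure_eq ▸ hd.closure_eq) x

/-- The inverse transform is continuous and vanishes at infinity (Riemann–Lebesgue), so its modulus
has a maximum. -/
theorem exists_eLpNorm_fourierInv_top_le {F : E → ℂ} (hF : Integrable F) :
    ∃ x, eLpNorm (𝓕⁻ F) ∞ (volume : Measure E) ≤ ‖𝓕⁻ F x‖ₑ := by
  have hc := continuous_fourierInv hF
  suffices ∃ x, ∀ y, ‖𝓕⁻ F y‖ ≤ ‖𝓕⁻ F x‖ by
    obtain ⟨x, hx⟩ := this
    refine ⟨x, ?_⟩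
    rw [eLpNorm_exponent_top]
    exact essSup_le_of_ae_le _ (Eventually.of_forall fun y => enorm_le_iff_norm_le.mpr (hx y))
  by_cases h0 : ∀ x, 𝓕⁻ F x = 0
  · exact ⟨0, fun y => by simp [h0]⟩
  push Not at h0
  obtain ⟨x₀, hx₀⟩ := h0
  refine hc.norm.exists_forall_ge' x₀ ?_
  have hlim := (tendsto_integral_exp_inner_smul_cocompact F).comp
    (Homeomorph.neg E).isClosedEmbedding.tendsto_cocompact
  have hlim' := hlim.norm
  rw [norm_zero] at hlim'
  filter_upwards [hlim'.eventually_lt_const (norm_pos_iff.mpr hx₀)] with x hx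
  refine le_of_lt ?_
  simpa [Real.fourierInv_eq] using hx

theorem fourierInv_modulation (G : E → ℂ) (α : ℝ) (β x : E) :
    𝓕⁻ (fun y => Complex.exp (Complex.I * ((α + ⟪β, y⟫ : ℝ) : ℂ)) * G y) x =
      Complex.exp (Complex.I * α) * 𝓕⁻ G (x + (2 * Real.pi)⁻¹ • β) := by
  rw [Real.fourierInv_eq', Real.fourierInv_eq', ← integral_const_mul]
  congr 1
  ext y
  simp only [smul_eq_mul]
  rw [← mul_assoc, ← mul_assoc, ← Complex.exp_add, ← Complex.exp_add, inner_add_right,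
    inner_smul_right, real_inner_comm β y]
  congr 2
  push_cast
  field_simp
  ring

/-- The equality case for the exponent `∞`. -/
theorem eLpNorm_fourierInv_top_eq_iff {F : E → ℂ} {G : E → ℝ≥0∞} (hF : Continuous F)
    (hG : Measurable G) (hle : ∀ᵐ x, ‖F x‖ₑ ≤ G x) (hGtop : ∀ x, G x ≠ ∞)
    (hGi : ∫⁻ x, G x < ∞) :
    eLpNorm (𝓕⁻ F) ∞ (volume : Measure E) =
        eLpNorm (𝓕⁻ fun y => ((G y).toReal : ℂ)) ∞ (volume : Measure E) ↔
      ∃ (α : ℝ) (β : E),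
        (∀ ξ, F ξ = Complex.exp (Complex.I * ((α + ⟪β, ξ⟫ : ℝ) : ℂ)) * (‖F ξ‖ : ℂ)) ∧
        ∀ᵐ ξ, ‖F ξ‖ₑ = G ξ := by
  have hFi : Integrable F := ⟨hF.aestronglyMeasurable, (lintegral_mono_ae hle).trans_lt hGi⟩
  have hGr : Integrable (fun y => ((G y).toReal : ℂ)) :=
    (integrable_toReal_of_lintegral_ne_top hG.aemeasurable hGi.ne).ofReal
  constructor
  · intro heq
    obtain ⟨x, hx⟩ := exists_eLpNorm_fourierInv_top_le hFi
    -- ∫ G is the value at 0 of the inverse transform of G, hence at most its sup norm.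
    have h0 : ∫⁻ t, G t ≤ ‖𝓕⁻ F x‖ₑ := by
      refine le_trans (le_trans ?_ (enorm_le_eLpNorm_top (continuous_fourierInv hGr) 0))
        (heq.symm.trans_le hx)
      rw [Real.fourierInv_eq']
      simp only [inner_zero_right, mul_zero, Complex.ofReal_zero, zero_mul, Complex.exp_zero,
        one_smul]
      rw [integral_complex_ofReal, integral_toReal hG.aemeasurable
        (Eventually.of_forall fun x => (hGtop x).lt_top), enorm_ofReal_toReal hGi.ne]
    set h : E → ℂ := fun t => Complex.exp (((2 * Real.pi * ⟪t, x⟫ : ℝ) : ℂ) * Complex.I) * F t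
      with hh
    have hhn (t : E) : ‖h t‖ = ‖F t‖ := by
      rw [hh, norm_mul, Complex.norm_exp_ofReal_mul_I, one_mul]
    have hhe (t : E) : ‖h t‖ₑ = ‖F t‖ₑ := enorm_eq_iff_norm_eq.mpr (hhn t)
    have hhc : Continuous h := by fun_prop
    have hFx : 𝓕⁻ F x = ∫ t, h t := by rw [Real.fourierInv_eq']; rfl
    rw [hFx] at h0
    have hhle : ∀ᵐ t, ‖h t‖ₑ ≤ G t := by
      filter_upwards [hle] with t ht
      rwa [hhe]
    have hl : ∫⁻ t, ‖h t‖ₑ < ∞ := (lintegral_mono_ae hhle).trans_lt hGi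
    obtain ⟨α, hα⟩ := exists_eq_mul_norm_of_lintegral_enorm_le hhc
      ⟨hhc.aestronglyMeasurable, hl⟩ ((lintegral_mono_ae hhle).trans h0)
    -- This frequency undoes the character at the maximum point x.
    refine ⟨α, -(2 * Real.pi) • x, fun ξ => ?_, ?_⟩
    · have e := hα ξ
      rw [hhn, hh] at e
      simp only at e
      rw [← mul_right_inj' (Complex.exp_ne_zero (((2 * Real.pi * ⟪ξ, x⟫ : ℝ) : ℂ) * Complex.I)), e,
        ← mul_assoc, ← Complex.exp_add, inner_smul_left, real_inner_comm ξ x]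
      congr 2
      simp only [conj_trivial]
      push_cast
      ring
    · have := ae_eq_of_ae_le_of_lintegral_le hhle hl.ne hG.aemeasurable
        (h0.trans (enorm_integral_le_lintegral_enorm _))
      filter_upwards [this] with t ht
      rw [← hhe, ht]
  · rintro ⟨α, β, h, hFG⟩
    rw [← eLpNorm_comp_measurePreserving (continuous_fourierInv hGr).aestronglyMeasurable
      (measurePreserving_add_right volume ((2 * Real.pi)⁻¹ • β))]
    refine eLpNorm_congr_norm_ae (Eventually.of_forall fun x => ?_)
    rw [Real.fourierInv_congr_ae (ae_eq_exp_mul_of_phase h hFG) x, fourierInv_modulation, norm_mul,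
      mul_comm Complex.I, Complex.norm_exp_ofReal_mul_I, one_mul]
    rfl

end Equality

/-! ### Assembly of the theorem. -/

theorem mainTheorem2 (d : ℕ) (p p' : ℝ≥0∞) [Fact (1 ≤ p)] [Fact (1 ≤ p')]
    (hp : (∃ m : ℕ, 2 ≤ m ∧ p = ((2 * m : ℕ) : ℝ≥0∞)) ∨ p = ∞)
    (hpp' : p⁻¹ + p'⁻¹ = 1)
    (f g : 𝓢'(Rd d, ℂ))
    (hf : f ∈ fourierImageLp d p') (hg : g ∈ fourierImageLp d p')
    (fhat ghat : Rd d → ℂ)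
    (hfhat : IsRepresentative p' (𝓕 f) fhat)
    (hghat : IsRepresentative p' (𝓕 g) ghat)
    (hle : ∀ᵐ ξ : Rd d, (ghat ξ).im = 0 ∧ ‖fhat ξ‖ ≤ (ghat ξ).re)
    (hcont : Continuous fhat)
    (hconn : IsPreconnected {ξ : Rd d | 0 < ‖fhat ξ‖}) :
    ∃ u v : Lp ℂ p (volume : Measure (Rd d)),
      (u : 𝓢'(Rd d, ℂ)) = f ∧ (v : 𝓢'(Rd d, ℂ)) = g ∧
      (‖u‖ = ‖v‖ ↔
        ∃ (α : ℝ) (β : Rd d) (ghat' : Rd d → ℂ),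
          Continuous ghat' ∧ ghat' =ᵐ[volume] ghat ∧
          ∀ ξ : Rd d,
            fhat ξ = Complex.exp (Complex.I * ((α + ⟪β, ξ⟫ : ℝ) : ℂ)) * ghat' ξ) := by
  obtain ⟨U, hU, hUf⟩ := hfhat
  obtain ⟨V, hV, hVg⟩ := hghat
  have hfU : f = 𝓕⁻ (U : 𝓢'(Rd d, ℂ)) := by rw [hU, FourierTransform.fourierInv_fourier_eq]
  have hgV : g = 𝓕⁻ (V : 𝓢'(Rd d, ℂ)) := by rw [hV, FourierTransform.fourierInv_fourier_eq]
  set G : Rd d → ℝ≥0∞ := fun ξ => ‖V ξ‖ₑ with hGdef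
  have hG : Measurable G := (Lp.stronglyMeasurable V).measurable.enorm
  have hGtop (ξ : Rd d) : G ξ ≠ ∞ := enorm_ne_top
  have hnn : ∀ᵐ ξ, ghat ξ = (‖ghat ξ‖ : ℂ) := by
    filter_upwards [hle] with ξ hξ
    refine Complex.eq_coe_norm_of_nonneg ?_
    rw [Complex.nonneg_iff]
    exact ⟨(norm_nonneg _).trans hξ.2, hξ.1.symm⟩
  have hgG : ∀ᵐ ξ, ghat ξ = ((G ξ).toReal : ℂ) := by
    filter_upwards [hnn, hVg] with ξ h1 h2
    rw [hGdef, toReal_enorm, h2]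
    exact h1
  have hleG : ∀ᵐ ξ, ‖fhat ξ‖ₑ ≤ G ξ := by
    filter_upwards [hle, hVg] with ξ h1 h2
    rw [hGdef, enorm_le_iff_norm_le, h2]
    exact h1.2.trans (Complex.re_le_norm _)
  have hVG : V =ᵐ[volume] fun ξ => ((G ξ).toReal : ℂ) := hVg.trans hgG
  have hGp : eLpNorm G p' volume < ∞ := by
    rw [hGdef, eLpNorm_enorm]
    exact Lp.eLpNorm_lt_top V
  -- The continuous representative is |fhat| itself; conversely, a continuous function that is a.e.
  -- nonnegative equals its modulus everywhere.
  have hiff : (∃ (α : ℝ) (β : Rd d),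
        (∀ ξ, fhat ξ = Complex.exp (Complex.I * ((α + ⟪β, ξ⟫ : ℝ) : ℂ)) * (‖fhat ξ‖ : ℂ)) ∧
        ∀ᵐ ξ, ‖fhat ξ‖ₑ = G ξ) ↔
      ∃ (α : ℝ) (β : Rd d) (ghat' : Rd d → ℂ),
        Continuous ghat' ∧ ghat' =ᵐ[volume] ghat ∧
        ∀ ξ : Rd d, fhat ξ = Complex.exp (Complex.I * ((α + ⟪β, ξ⟫ : ℝ) : ℂ)) * ghat' ξ := by
    refine exists_congr fun α => exists_congr fun β => ⟨fun ⟨h1, h2⟩ => ?_, ?_⟩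
    · refine ⟨fun ξ => (‖fhat ξ‖ : ℂ), by fun_prop, ?_, h1⟩
      filter_upwards [h2, hgG] with ξ e1 e2
      rw [e2, ← e1, toReal_enorm]
    · rintro ⟨ghat', hc, hae, h⟩
      have hn : ghat' = fun ξ => (‖ghat' ξ‖ : ℂ) := by
        refine (Continuous.ae_eq_iff_eq volume hc (by fun_prop)).mp ?_
        filter_upwards [hae, hnn] with ξ e1 e2
        rw [e1]
        exact e2
      have hnorm (ξ : Rd d) : ‖fhat ξ‖ = ‖ghat' ξ‖ := by
        rw [h ξ, norm_mul, mul_comm Complex.I, Complex.norm_exp_ofReal_mul_I, one_mul]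
      refine ⟨fun ξ => ?_, ?_⟩
      · rw [hnorm, ← congrFun hn ξ]
        exact h ξ
      · filter_upwards [hae, hVg] with ξ e1 e2
        rw [hGdef, enorm_eq_iff_norm_eq, hnorm, e1, e2]
  rw [← hiff]
  have hnorm_iff (u v : Lp ℂ p (volume : Measure (Rd d))) : ‖u‖ = ‖v‖ ↔ ‖u‖ₑ = ‖v‖ₑ :=
    enorm_eq_iff_norm_eq.symm
  rcases hp with ⟨m, hm, hp⟩ | rfl
  · obtain ⟨k, rfl⟩ : ∃ k, m = k + 1 := ⟨m - 1, by lia⟩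
    obtain ⟨u, hu, hun⟩ := exists_Lp_eq_fourierInv hcont.measurable hp hpp' hUf
    obtain ⟨v, hv, hvn⟩ := exists_Lp_eq_fourierInv
      (F := fun ξ => ((G ξ).toReal : ℂ)) (by fun_prop) hp hpp' hVG
    refine ⟨u, v, hu.trans hfU.symm, hv.trans hgV.symm, ?_⟩
    rw [hnorm_iff, ← (ENNReal.pow_right_strictMono k.succ_ne_zero).injective.eq_iff]
    simp only [Nat.succ_eq_add_one]
    rw [hun, hvn]
    exact eLpNorm_convPow_eq_iff (by lia) hp hpp' hcont hG hleG hGtop hGp hconn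
  · obtain rfl : p' = 1 := by simpa using hpp'
    have hGi : ∫⁻ ξ, G ξ < ∞ := by simpa [eLpNorm_one_eq_lintegral_enorm] using hGp
    have hFi : Integrable fhat := (L1.integrable_coeFn U).congr hUf
    have hGr : Integrable (fun ξ => ((G ξ).toReal : ℂ)) := (L1.integrable_coeFn V).congr hVG
    have mu := memLp_top_fourierInv hFi
    have mv := memLp_top_fourierInv hGr
    refine ⟨mu.toLp _, mv.toLp _, ?_, ?_, ?_⟩
    · rw [hfU]
      exact fourierInv_toTemperedDistribution_eq_of_ae_eq hFi hUf mu.coeFn_toLp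
    · rw [hgV]
      exact fourierInv_toTemperedDistribution_eq_of_ae_eq hGr hVG mv.coeFn_toLp
    · rw [hnorm_iff, Lp.enorm_def, Lp.enorm_def, eLpNorm_congr_ae mu.coeFn_toLp,
        eLpNorm_congr_ae mv.coeFn_toLp]
      exact eLpNorm_fourierInv_top_eq_iff hcont hG hleG hGtop hGi
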